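/- **Model.** A $2$-dimensional linear program with $n$ constraints asks for a point $x\in\mathbb{R}^2$ minimizing $c_1x_1+c_2x_2$ subject to $a^j_1x_1+a^j_2x_2\le b^j$ for $j=1,\dots,n$. An $r$-pass streaming algorithm with $s$ bits of space knows $n$ and the objective $(c_1,c_2)$ in advance and scans the sequence of constraints $r$ times in the given order; each time it reads a constraint it updates its $s$-bit memory by an arbitrary function of the objective, the pass number, the position in the stream, the current memory content and the constraint just read; after the last pass it outputs a point of $\mathbb{R}^2$ that is a function of the objective and the memory content. A randomized streaming algorithm is a probability distribution over such deterministic algorithms, independent of the input (the random seed is not charged to the space). **Theorem.** There are absolute constants $c>0$ and $K\in\mathbb{N}$ such that the following holds for all integers $r\ge 1$, $n\ge 1$ and $s\ge 0$. Suppose that a randomized $r$-pass streaming algorithm with $s$ bits of space outputs, with probability at least $2/3$, an optimal solution of the linear program, for every $2$-dimensional linear program with $n$ constraints that has an optimal solution and in which all numbers $c_i,a^j_i,b^j$ are integers of absolute value at most $n^K$ (so each has bit-complexity $O(\log n)$). Then $$ s\;\ge\; c\cdot\frac{1}{r^{3}}\cdot n^{1/(2r)} .$$ In other words, any $r$-pass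 randomized streaming algorithm that solves $2$-dimensional linear programs with $n$ constraints with probability at least $2/3$ needs $\Omega\big(n^{1/(2r)}/r^3\big)$ bits of space, even when every input number has only $O(\log n)$ bits. -/

import Mathlib

/-- A linear constraint `∑ i, a i * x i ≤ b` in `d` real variables. -/
structure LinearConstraint (d : ℕ) where
  coeff : Fin d → ℝ
  bound : ℝ

/-- The point `x` satisfies the constraint. -/
def LinearConstraint.Holds {d : ℕ} (C : LinearConstraint d) (x : Fin d → ℝ) : Prop :=
  ∑ i, C.coeff i * x i ≤ C.bound

/-- A `d`-dimensional linear program with a sequence of `n` constraints: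
minimize `∑ i, objective i * x i` over `x ∈ ℝ^d` subject to all constraints. -/
structure LinearProgram (d n : ℕ) where
  objective : Fin d → ℝ
  constraint : Fin n → LinearConstraint d

namespace LinearProgram

variable {d n : ℕ}

/-- The objective value of a point. -/
def value (P : LinearProgram d n) (x : Fin d → ℝ) : ℝ :=
  ∑ i, P.objective i * x i

/-- The point `x` satisfies every constraint. -/
def Feasible (P : LinearProgram d n) (x : Fin d → ℝ) : Prop :=
  ∀ j, (P.constraint j).Holds x

/-- The point `x` is an optimal solution (ties are allowed, any minimizer counts). -/
def IsOptimal (P : LinearProgram d n) (x : Fin d → ℝ) : Prop :=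
  P.Feasible x ∧ ∀ y, P.Feasible y → P.value x ≤ P.value y

/-- Every number of the input (objective and constraints) is an integer of absolute value
at most `M`. For `M = n ^ K` this says that every number is given by `O(K log n)` bits. -/
def IntegralBoundedBy (P : LinearProgram d n) (M : ℕ) : Prop :=
  (∀ i, ∃ z : ℤ, P.objective i = z ∧ |z| ≤ M) ∧
  (∀ j i, ∃ z : ℤ, (P.constraint j).coeff i = z ∧ |z| ≤ M) ∧
  (∀ j, ∃ z : ℤ, (P.constraint j).bound = z ∧ |z| ≤ M)

end LinearProgram

/-- A deterministic streaming algorithm for `d`-dimensional linear programs with `n` constraints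
that makes `r` passes over the constraints and has `s` bits of memory.
The objective function is known in advance, free of charge. On reading the `j`-th constraint during
pass `t`, the algorithm updates its memory by an arbitrary function of the objective, `t`, `j`, the
current memory and that constraint (so it is non-uniform, computationally unbounded, and has a
clock free of charge). After the last pass the answer is a function of the memory content and the
objective. -/
structure StreamingAlgorithm (d n r s : ℕ) where
  start : (Fin d → ℝ) → (Fin s → Bool)
  step : (Fin d → ℝ) → Fin r → Fin n → (Fin s → Bool) → LinearConstraint d → (Fin s → Bool)
  answer : (Fin d → ℝ) → (Fin s → Bool) → (Fin d → ℝ)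

namespace StreamingAlgorithm

variable {d n r s : ℕ}

/-- The memory after pass `t`, which reads the constraints `0, …, n - 1` in this order,
starting from memory `m`. -/
def onePass (A : StreamingAlgorithm d n r s) (P : LinearProgram d n) (t : Fin r)
    (m : Fin s → Bool) : Fin s → Bool :=
  Fin.foldl n (fun m j => A.step P.objective t j m (P.constraint j)) m

/-- The memory after all `r` passes. -/
def finalMemory (A : StreamingAlgorithm d n r s) (P : LinearProgram d n) : Fin s → Bool :=
  Fin.foldl r (fun m t => A.onePass P t m) (A.start P.objective)

/-- The point that the algorithm returns on the linear program `P`. -/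
def run (A : StreamingAlgorithm d n r s) (P : LinearProgram d n) : Fin d → ℝ :=
  A.answer P.objective (A.finalMemory P)

end StreamingAlgorithm

/-- A randomized streaming algorithm is a random deterministic one: `A ω` is the algorithm for the
random seed `ω ∈ Ω`, drawn from `μ` independently of the input; the seed is accessible throughout
and is not charged as memory. It solves `P` with probability at least `p` if with probability at
least `p` the returned point is an optimal solution of `P`. -/
def SolvesWithProb {Ω : Type*} [MeasurableSpace Ω] (μ : MeasureTheory.Measure Ω) {d n r s : ℕ}
    (A : Ω → StreamingAlgorithm d n r s) (P : LinearProgram d n) (p : ℝ) : Prop :=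
  MeasurableSet {ω | P.IsOptimal ((A ω).run P)} ∧ p ≤ μ.real {ω | P.IsOptimal ((A ω).run P)}

/-! Cutting the stream in two turns `r` passes with `s` bits of memory into a two-player protocol of
`2 * r - 1` messages of `s` bits, so it suffices to build programs whose optimal value is hard to
find in that many rounds.

The hard function starts as one bit that the announcing player does not hold. A round is added by
indexing: the new first speaker holds `N` independent inputs, the other player an index `i` and the
partner input for position `i`. A message short compared with `N` says little about a typical
position, so `sum_agree_index_le` lets the success rate grow by only `lam + s / (lam * N)`. With `N`
of order `r ^ 2 * s` it stays at most `5 / 8`, below `2 / 3`.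

Geometrically, the answer is the parity of the rescaled abscissa of the leftmost point above one
player's lines and below the other's. `CrossingFamily.succ` realises indexing: shrunken, reflected
copies of the `N` line sets are attached to the tangents of a parabola at `0, …, N - 1`. Near the
tangent point over `i` all other copies lie lower, so lines attached to tangent `i` interact only
with copy `i`. The reflection exchanges above and below, just as the players exchange roles. Each
round costs a factor `N` in the number of lines and `O(log N)` bits per coefficient. -/

/-! ### Two-party protocols. -/

/-- `Computes M k g` says that some deterministic two-party protocol with `k` alternating messages
from `M` computes `g`: the owner of the first argument sends the first message, and the player
whose turn it is after the last message announces the output. -/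
def Computes (M : Type) : ℕ → ∀ {X Y : Type}, (X → Y → Bool) → Prop
  | 0, X, _, g => ∃ h : X → Bool, ∀ x y, g x y = h x
  | k + 1, X, Y, g => ∃ (m : X → M) (g' : M → Y → X → Bool),
      (∀ μ, Computes M k (g' μ)) ∧ ∀ x y, g x y = g' (m x) y x

namespace Computes

variable {M : Type}

theorem comap {k : ℕ} : ∀ {X Y X' Y' : Type} {g : X → Y → Bool}, Computes M k g →
    ∀ (φ : X' → X) (ψ : Y' → Y), Computes M k (fun x y => g (φ x) (ψ y)) := by
  induction k with
  | zero =>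
    rintro X Y X' Y' g ⟨h, hh⟩ φ ψ
    exact ⟨fun x => h (φ x), fun x y => hh _ _⟩
  | succ k ih =>
    rintro X Y X' Y' g ⟨m, g', hg', hg⟩ φ ψ
    exact ⟨fun x => m (φ x), fun μ y x => g' μ (ψ y) (φ x), fun μ => ih (hg' μ) ψ φ,
      fun x y => hg _ _⟩

/-- A state that is updated alternately by the two players `2 * (r + 1)` times is determined by
`2 * r + 1` messages and the input of the second player. -/
theorem of_foldl {X Y : Type} (out : M → Bool) (r : ℕ) :
    ∀ (α : Fin (r + 1) → M → X → M) (β : Fin (r + 1) → M → Y → M) (m : M),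
      Computes M (2 * r + 1)
        (fun x y => out (Fin.foldl (r + 1) (fun m t => β t (α t m x) y) m)) := by
  induction r with
  | zero =>
    intro α β m
    -- The last update is made by the second player, who announces the output, so that state is
    -- never sent.
    refine ⟨fun x => α 0 m x, fun μ y _ => out (β 0 μ y), fun μ => ⟨_, fun _ _ => rfl⟩, ?_⟩
    intro x y
    simp [Fin.foldl_succ]
  | succ r ih =>
    intro α β m
    refine ⟨fun x => α 0 m x, fun μ y x => out (Fin.foldl (r + 1)
      (fun m t => β t.succ (α t.succ m x) y) (β 0 μ y)), fun μ => ?_, ?_⟩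
    · exact ⟨fun y => β 0 μ y, fun ν x y => out (Fin.foldl (r + 1)
        (fun m t => β t.succ (α t.succ m x) y) ν),
        fun ν => ih (fun t => α t.succ) (fun t => β t.succ) ν, fun _ _ => rfl⟩
    · intro x y
      simp only [Fin.foldl_succ (n := r + 1)]

end Computes

/-! ### Round elimination by exponential moments. -/

/-- If each `h i` is `[0, 1]`-valued with mean at most `q`, then the exponential moment of
`∑ i, h i (w i)` for uniform `w` is subgaussian. -/
theorem sum_exp_sum_le {Y : Type} [Fintype Y] {N : ℕ} (h : Fin N → Y → ℝ)
    (h0 : ∀ i y, 0 ≤ h i y) (h1 : ∀ i y, h i y ≤ 1) {q lam : ℝ} (hl0 : 0 ≤ lam) (hl1 : lam ≤ 1)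
    (hq : ∀ i, ∑ y, h i y ≤ q * Fintype.card Y) :
    ∑ w : Fin N → Y, Real.exp (lam * ∑ i, h i (w i)) ≤
      Real.exp (N * (lam * q + lam ^ 2)) * Fintype.card (Fin N → Y) := by
  classical
  have hone : ∀ i, ∑ y, Real.exp (lam * h i y) ≤
      Real.exp (lam * q + lam ^ 2) * Fintype.card Y := by
    intro i
    have hpt : ∀ y, Real.exp (lam * h i y) ≤ 1 + lam * h i y + lam ^ 2 := by
      intro y
      have hnn : 0 ≤ lam * h i y := mul_nonneg hl0 (h0 i y)
      have hle : lam * h i y ≤ lam := mul_le_of_le_one_right hl0 (h1 i y)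
      have := (abs_le.1 (Real.abs_exp_sub_one_sub_id_le
        (abs_le.2 ⟨by linarith, hle.trans hl1⟩))).2
      nlinarith [pow_le_pow_left₀ hnn hle 2]
    calc ∑ y, Real.exp (lam * h i y) ≤ ∑ y, (1 + lam * h i y + lam ^ 2) :=
          Finset.sum_le_sum fun y _ => hpt y
      _ = Fintype.card Y * (1 + lam ^ 2) + lam * ∑ y, h i y := by
          simp only [Finset.sum_add_distrib, ← Finset.mul_sum, Finset.sum_const,
            Finset.card_univ, nsmul_eq_mul]
          ring
      _ ≤ Fintype.card Y * (1 + lam ^ 2) + lam * (q * Fintype.card Y) := by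
          gcongr; exact hq i
      _ = (lam * q + lam ^ 2 + 1) * Fintype.card Y := by ring
      _ ≤ _ := by gcongr; exact Real.add_one_le_exp _
  calc ∑ w : Fin N → Y, Real.exp (lam * ∑ i, h i (w i))
      = ∏ i, ∑ y, Real.exp (lam * h i y) := by
        rw [Finset.prod_univ_sum, Fintype.piFinset_univ]
        simp only [Finset.mul_sum, Real.exp_sum]
    _ ≤ ∏ _i : Fin N, (Real.exp (lam * q + lam ^ 2) * Fintype.card Y) :=
        Finset.prod_le_prod (fun i _ => Finset.sum_nonneg fun y _ => (Real.exp_pos _).le)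
          fun i _ => hone i
    _ = _ := by
        simp [mul_pow, ← Real.exp_nat_mul]

/-- A message `m w` of `s` bits about a uniform tuple `w` helps little to make the average of
`h (m w) i (w i)` over `i` large. -/
theorem sum_message_le {Y : Type} [Fintype Y] {N s : ℕ} (h : (Fin s → Bool) → Fin N → Y → ℝ)
    (h0 : ∀ μ i y, 0 ≤ h μ i y) (h1 : ∀ μ i y, h μ i y ≤ 1) {q lam : ℝ} (hl0 : 0 < lam)
    (hl1 : lam ≤ 1) (hq : ∀ μ i, ∑ y, h μ i y ≤ q * Fintype.card Y)
    (m : (Fin N → Y) → Fin s → Bool) :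
    ∑ w : Fin N → Y, ∑ i, h (m w) i (w i) ≤
      (N * (q + lam) + s / lam) * Fintype.card (Fin N → Y) := by
  classical
  set c : ℝ := s + N * (lam * q + lam ^ 2) with hc
  have key : ∑ w : Fin N → Y, Real.exp (lam * ∑ i, h (m w) i (w i)) ≤
      Real.exp c * Fintype.card (Fin N → Y) := by
    -- Union bound: the actual message is one of `2 ^ s`, and for a fixed message the coordinates
    -- are independent.
    calc _ ≤ ∑ w : Fin N → Y, ∑ μ, Real.exp (lam * ∑ i, h μ i (w i)) :=
          Finset.sum_le_sum fun w _ => Finset.single_le_sum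
            (f := fun μ => Real.exp (lam * ∑ i, h μ i (w i)))
            (fun μ _ => (Real.exp_pos _).le) (Finset.mem_univ (m w))
      _ = ∑ μ, ∑ w : Fin N → Y, Real.exp (lam * ∑ i, h μ i (w i)) := Finset.sum_comm
      _ ≤ ∑ _μ : Fin s → Bool,
            Real.exp (N * (lam * q + lam ^ 2)) * Fintype.card (Fin N → Y) :=
          Finset.sum_le_sum fun μ _ => sum_exp_sum_le (h μ) (h0 μ) (h1 μ) hl0.le hl1 (hq μ)
      _ = 2 ^ s * (Real.exp (N * (lam * q + lam ^ 2)) * Fintype.card (Fin N → Y)) := by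
          simp
      _ ≤ Real.exp s * (Real.exp (N * (lam * q + lam ^ 2)) * Fintype.card (Fin N → Y)) := by
          gcongr
          rw [← mul_one (s : ℝ), Real.exp_nat_mul]
          exact pow_le_pow_left₀ (by norm_num) (by linarith [Real.add_one_le_exp (1 : ℝ)]) _
      _ = _ := by rw [← mul_assoc, ← Real.exp_add]
  -- The tangent bound `1 + t ≤ exp t` at `t = lam * ∑ - c` replaces Jensen's inequality.
  have lower : ∑ w : Fin N → Y, (1 + (lam * ∑ i, h (m w) i (w i) - c)) ≤
      Fintype.card (Fin N → Y) := by
    calc _ ≤ ∑ w : Fin N → Y, Real.exp (lam * ∑ i, h (m w) i (w i)) * Real.exp (-c) :=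
          Finset.sum_le_sum fun w _ => by
            rw [← Real.exp_add]
            linarith [Real.add_one_le_exp (lam * ∑ i, h (m w) i (w i) + -c)]
      _ ≤ Real.exp c * Fintype.card (Fin N → Y) * Real.exp (-c) := by
          rw [← Finset.sum_mul]; gcongr
      _ = _ := by
          rw [mul_right_comm, ← Real.exp_add]; simp
  rw [Finset.sum_add_distrib, Finset.sum_sub_distrib, ← Finset.mul_sum] at lower
  simp only [Finset.sum_const, Finset.card_univ, nsmul_eq_mul, mul_one] at lower
  have : lam * ∑ w : Fin N → Y, ∑ i, h (m w) i (w i) ≤ c * Fintype.card (Fin N → Y) := by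
    linarith
  rw [← mul_le_mul_iff_right₀ hl0]
  refine this.trans_eq ?_
  rw [hc]
  field_simp
  ring

/-- Round elimination: if `k` messages of `s` bits compute `F` on at most a fraction `q` of the
inputs, then with `k + 1` messages the composition of `F` with indexing into `N` independent
inputs is computed on at most a fraction `q + lam + s / (lam * N)`. -/
theorem sum_agree_index_le {X Y : Type} [Fintype X] [Fintype Y] {N s k : ℕ} (hN : 1 ≤ N)
    {F : X → Y → Bool} {q lam : ℝ} (hl0 : 0 < lam) (hl1 : lam ≤ 1) [Nonempty X]
    (hF : ∀ g, Computes (Fin s → Bool) k g →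
      ∑ x, ∑ y, (if g x y = F x y then (1 : ℝ) else 0) ≤
        q * (Fintype.card X * Fintype.card Y))
    (g : (Fin N → Y) → Fin N × X → Bool) (hg : Computes (Fin s → Bool) (k + 1) g) :
    ∑ w, ∑ v, (if g w v = F v.2 (w v.1) then (1 : ℝ) else 0) ≤
      (q + (lam + s / (lam * N))) *
        (Fintype.card (Fin N → Y) * Fintype.card (Fin N × X)) := by
  classical
  obtain ⟨m, g', hg', hgg⟩ := hg
  have hNR : (0 : ℝ) < N := by exact_mod_cast hN
  have hX : (0 : ℝ) < Fintype.card X := by exact_mod_cast Fintype.card_pos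
  let S : (Fin s → Bool) → Fin N → Y → (Fin N → Y) → ℝ := fun μ i y w =>
    ∑ z, if g' μ (i, z) w = F z y then (1 : ℝ) else 0
  -- For a fixed message and index, the owner of `y` may continue with the most favourable tuple. It
  -- need not have `y` at position `i` nor produce the message `μ`; it only has to yield a
  -- `k`-message protocol on `X × Y`.
  have hmax : ∀ μ i y, ∃ w : Fin N → Y, ∀ w', S μ i y w' ≤ S μ i y w := fun μ i y =>
    have : Nonempty (Fin N → Y) := ⟨fun _ => y⟩
    Finite.exists_max (S μ i y)
  choose φ hφ using hmax
  have hS0 : ∀ μ i y w, 0 ≤ S μ i y w := fun μ i y w =>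
    Finset.sum_nonneg fun z _ => by split_ifs <;> norm_num
  have hS1 : ∀ μ i y w, S μ i y w ≤ Fintype.card X := fun μ i y w => by
    calc S μ i y w ≤ ∑ _z : X, (1 : ℝ) :=
          Finset.sum_le_sum fun z _ => by split_ifs <;> norm_num
      _ = _ := by simp
  have main := sum_message_le (fun μ i y => S μ i y (φ μ i y) / Fintype.card X)
    (fun μ i y => div_nonneg (hS0 _ _ _ _) hX.le)
    (fun μ i y => div_le_one_of_le₀ (hS1 _ _ _ _) hX.le) hl0 hl1 (q := q) (by
      intro μ i
      have := hF _ ((hg' μ).comap (fun z : X => (i, z)) (φ μ i))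
      rw [Finset.sum_comm] at this
      rw [← Finset.sum_div, div_le_iff₀ hX]
      exact this.trans_eq (by ring)) m
  calc ∑ w, ∑ v : Fin N × X, (if g w v = F v.2 (w v.1) then (1 : ℝ) else 0)
      = ∑ w, ∑ i, S (m w) i (w i) w := by
        refine Finset.sum_congr rfl fun w _ => ?_
        rw [Fintype.sum_prod_type]
        simp only [S, hgg]
    _ ≤ ∑ w, ∑ i, Fintype.card X *
          (S (m w) i (w i) (φ (m w) i (w i)) / Fintype.card X) := by
        refine Finset.sum_le_sum fun w _ => Finset.sum_le_sum fun i _ => ?_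
        rw [mul_div_cancel₀ _ hX.ne']
        exact hφ _ _ _ _
    _ ≤ Fintype.card X * ((N * (q + lam) + s / lam) * Fintype.card (Fin N → Y)) := by
        simp only [← Finset.mul_sum]
        exact mul_le_mul_of_nonneg_left main hX.le
    _ = _ := by
        rw [Fintype.card_prod, Fintype.card_fin]
        push_cast
        field_simp
        ring

/-! ### Lines attached to tangents of a parabola. -/

/-- The line `v = l.1 * u + l.2`, reflected in the horizontal axis, shrunk by `1 / (16 * N)`
horizontally and by its square vertically, and moved by the affine map that takes the horizontal
axis with the origin to the tangent of the parabola `v = u ^ 2` at `u = j`. -/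
noncomputable def tangentLine (N j : ℕ) (l : ℝ × ℝ) : ℝ × ℝ :=
  (2 * j - l.1 / (16 * N), -(j : ℝ) ^ 2 + l.1 * j / (16 * N) - l.2 / (16 * N) ^ 2)

/-- The value of a line, viewed as an affine function. -/
def lineEval (l : ℝ × ℝ) (u : ℝ) : ℝ := l.1 * u + l.2

/-- The line has bounded slope and intercept, with denominators dividing `(16 * N) ^ (2 * k)`. -/
structure AdmissibleLine (N k : ℕ) (l : ℝ × ℝ) : Prop where
  slope_le : |l.1| ≤ 2 * N + 1
  intercept_le : |l.2| ≤ 4 * N ^ 2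
  slope_int : ∃ z : ℤ, l.1 * (16 * N) ^ (2 * k) = z
  intercept_int : ∃ z : ℤ, l.2 * (16 * N) ^ (2 * k) = z

theorem abs_div_le_of_le_mul {x y c : ℝ} (hy : 0 < y) (h : |x| ≤ c * y) : |x / y| ≤ c := by
  rwa [abs_div, abs_of_pos hy, div_le_iff₀ hy]

namespace AdmissibleLine

variable {N k : ℕ} {l : ℝ × ℝ}

theorem slope_div_le (hN : 1 ≤ N) (hl : AdmissibleLine N k l) : |l.1 / (16 * N)| ≤ 3 / 16 := by
  have hNR : (1 : ℝ) ≤ N := by exact_mod_cast hN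
  exact abs_div_le_of_le_mul (by positivity) (hl.slope_le.trans (by linarith))

theorem intercept_div_le (hN : 1 ≤ N) (hl : AdmissibleLine N k l) :
    |l.2 / (16 * N) ^ 2| ≤ 1 / 64 := by
  have hNR : (1 : ℝ) ≤ N := by exact_mod_cast hN
  exact abs_div_le_of_le_mul (by positivity) (hl.intercept_le.trans (by linarith))

/-- The factor 16 makes shrunken slopes and intercepts at most `3 / 16` and `1 / 64`, so the size
bounds do not grow with `k`. -/
theorem tangentLine (hN : 1 ≤ N) (hl : AdmissibleLine N k l) {j : ℕ} (hj : j < N) :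
    AdmissibleLine N (k + 1) (tangentLine N j l) := by
  have hNR : (1 : ℝ) ≤ N := by exact_mod_cast hN
  have hjR : (j : ℝ) + 1 ≤ N := by exact_mod_cast hj
  have hj0 : (0 : ℝ) ≤ j := Nat.cast_nonneg j
  obtain ⟨ha, ha'⟩ := abs_le.1 (hl.slope_div_le hN)
  obtain ⟨hb, hb'⟩ := abs_le.1 (hl.intercept_div_le hN)
  obtain ⟨A, hA⟩ := hl.slope_int
  obtain ⟨B, hB⟩ := hl.intercept_int
  have hpow : (16 * (N : ℝ)) ^ (2 * (k + 1)) = (16 * N) ^ (2 * k) * (16 * N) ^ 2 := by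
    rw [← pow_add]; ring_nf
  constructor
  · rw [abs_le]
    constructor <;> simp only [_root_.tangentLine] <;> linarith
  · rw [abs_le, _root_.tangentLine, mul_div_right_comm]
    constructor <;> nlinarith
  · refine ⟨2 * j * (16 * N) ^ (2 * (k + 1)) - A * (16 * N), ?_⟩
    push_cast
    rw [← hA, _root_.tangentLine, hpow]
    field_simp
  · refine ⟨-j ^ 2 * (16 * N) ^ (2 * (k + 1)) + A * j * (16 * N) - B, ?_⟩
    push_cast
    rw [← hA, ← hB, _root_.tangentLine, hpow]
    field_simp

end AdmissibleLine

/-- The affine map reverses vertical order on its own tangent, hence turns "above" constraints into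
"below" ones. -/
theorem lineEval_tangentLine_self {N : ℕ} (hN : 1 ≤ N) (i : ℕ) (l : ℝ × ℝ) (p : ℝ) :
    lineEval (tangentLine N i l) (i + p / (16 * N)) =
      2 * i * (i + p / (16 * N)) - i ^ 2 - lineEval l p / (16 * N) ^ 2 := by
  have hNR : (1 : ℝ) ≤ N := by exact_mod_cast hN
  simp only [lineEval, tangentLine]
  field_simp
  ring

/-- Near the tangent point over `i`, lines that belong to other tangents are below. -/
theorem lineEval_tangentLine_le {N k i j : ℕ} (hN : 1 ≤ N) (hij : i ≠ j) {l : ℝ × ℝ}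
    (hl : AdmissibleLine N k l) {p q : ℝ} (hp0 : 0 ≤ p) (hpN : p ≤ N) (hq : |q| ≤ 4 * N ^ 2) :
    lineEval (tangentLine N j l) (i + p / (16 * N)) ≤
      2 * i * (i + p / (16 * N)) - i ^ 2 - q / (16 * N) ^ 2 := by
  have hNR : (1 : ℝ) ≤ N := by exact_mod_cast hN
  obtain ⟨ha, ha'⟩ := abs_le.1 (hl.slope_div_le hN)
  obtain ⟨hb, hb'⟩ := abs_le.1 (hl.intercept_div_le hN)
  have hq' : |q / (16 * N) ^ 2| ≤ 1 / 64 :=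
    abs_div_le_of_le_mul (by positivity) (hq.trans (by linarith))
  have hq'' := (abs_le.1 hq').2
  have ht0 : 0 ≤ p / (16 * N) := by positivity
  have ht1 : p / (16 * N) ≤ 1 / 16 := by
    rw [div_le_iff₀ (by positivity)]; linarith
  simp only [lineEval, tangentLine, mul_div_right_comm]
  generalize l.1 / (16 * N) = a at *
  generalize l.2 / (16 * N) ^ 2 = b at *
  generalize q / (16 * N) ^ 2 = c at *
  generalize p / (16 * N) = t at *
  obtain ⟨d, hd⟩ : ∃ d : ℝ, d = (i : ℝ) - j := ⟨_, rfl⟩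
  -- Here `d ^ 2 + 2 * d * t` is the gap between the tangents at `i` and `j` over `i + t`; the other
  -- terms are the small perturbations.
  suffices 0 ≤ d ^ 2 + 2 * d * t + a * (d + t) + b - c by
    rw [hd] at this
    linarith
  rcases lt_or_gt_of_ne hij with h | h
  · have h1 : d ≤ -1 := by
      have : (i : ℝ) + 1 ≤ j := by exact_mod_cast h
      linarith
    nlinarith [mul_nonneg (sub_nonneg.2 ha') (by linarith : 0 ≤ -d - t),
      mul_nonneg (sub_nonneg.2 ht1) (by linarith : 0 ≤ -d)]
  · have h1 : 1 ≤ d := by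
      have : (j : ℝ) + 1 ≤ i := by exact_mod_cast h
      linarith
    nlinarith [mul_nonneg (by linarith : 0 ≤ a + 3 / 16) (by linarith : 0 ≤ d + t),
      mul_nonneg (by linarith : 0 ≤ d) ht0]

/-- Two families of sets of lines such that the region above the lines of `f x` and below those of
`g y` has its leftmost point `(p, q)` at a crossing, where the integer `p * (16 * N) ^ k` is odd
if and only if `F x y` holds. -/
structure CrossingFamily (N k : ℕ) {X Y : Type} (f : X → List (ℝ × ℝ)) (g : Y → List (ℝ × ℝ))
    (F : X → Y → Bool) : Prop where
  length_left : ∀ x, (f x).length ≤ N ^ k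
  length_right : ∀ y, (g y).length ≤ N ^ k
  admissible_left : ∀ x, ∀ l ∈ f x, AdmissibleLine N k l
  admissible_right : ∀ y, ∀ l ∈ g y, AdmissibleLine N k l
  crossing : ∀ x y, ∃ p q : ℝ, 0 ≤ p ∧ p ≤ N ∧ |q| ≤ 4 * N ^ 2 ∧
    (∀ l ∈ f x, lineEval l p ≤ q) ∧ (∀ l ∈ g y, q ≤ lineEval l p) ∧
    (∃ l ∈ f x, ∃ l' ∈ g y, lineEval l p = q ∧ lineEval l' p = q ∧ l.1 < l'.1) ∧
    ∃ z : ℤ, p * (16 * N) ^ k = z ∧ (Odd z ↔ F x y = true)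

namespace CrossingFamily

/-- The lines `v = 0` and `v = u - b` cross at `u = b`, for the bit `b`. -/
theorem base {N : ℕ} (hN : 1 ≤ N) :
    CrossingFamily N 0 (fun _ : Unit => [(0, 0)]) (fun b : Bool => [(1, if b then -1 else 0)])
      (fun _ b => b) := by
  have hNR : (1 : ℝ) ≤ N := by exact_mod_cast hN
  refine ⟨by simp, by simp, ?_, ?_, ?_⟩
  · intro x l hl
    obtain rfl : l = (0, 0) := by simpa using hl
    exact ⟨by simp; positivity, by simp, ⟨0, by simp⟩, ⟨0, by simp⟩⟩
  · intro b l hl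
    obtain rfl : l = (1, if b then -1 else 0) := by simpa using hl
    refine ⟨by simp, ?_, ⟨1, by simp⟩, ⟨if b then -1 else 0, by cases b <;> simp⟩⟩
    cases b
    · simp
    · simp only [if_true, abs_neg, abs_one]
      nlinarith
  · intro x b
    refine ⟨if b then 1 else 0, 0, ?_, ?_, ?_, ?_, ?_, ?_, if b then 1 else 0, ?_, ?_⟩
    all_goals cases b <;> simp [lineEval, hN]

theorem succ {N k : ℕ} (hN : 1 ≤ N) {X Y : Type} {f : X → List (ℝ × ℝ)} {g : Y → List (ℝ × ℝ)}
    {F : X → Y → Bool} (h : CrossingFamily N k f g F) :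
    CrossingFamily N (k + 1)
      (fun w : Fin N → Y => (List.finRange N).flatMap fun j => (g (w j)).map (tangentLine N j))
      (fun v : Fin N × X => (f v.2).map (tangentLine N v.1))
      (fun w v => F v.2 (w v.1)) := by
  have hNR : (1 : ℝ) ≤ N := by exact_mod_cast hN
  refine ⟨?_, ?_, ?_, ?_, ?_⟩
  · intro w
    rw [List.length_flatMap]
    refine (List.sum_le_card_nsmul _ (N ^ k) ?_).trans_eq ?_
    · intro x hx
      obtain ⟨j, -, rfl⟩ := List.mem_map.1 hx
      simpa using h.length_right _
    · simp [pow_succ']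
  · intro v
    rw [List.length_map]
    exact (h.length_left _).trans (Nat.pow_le_pow_right hN (Nat.le_succ k))
  · intro w l hl
    simp only [List.mem_flatMap, List.mem_map] at hl
    obtain ⟨j, -, l, hl, rfl⟩ := hl
    exact (h.admissible_right _ l hl).tangentLine hN j.2
  · intro v l hl
    obtain ⟨l₀, hl₀, rfl⟩ := List.mem_map.1 hl
    exact (h.admissible_left _ l₀ hl₀).tangentLine hN v.1.2
  · rintro w ⟨i, x⟩
    obtain ⟨p, q, hp0, hpN, hq, hf, hg, ⟨l, hl, l', hl', e, e', hlt⟩, z, hz, hodd⟩ :=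
      h.crossing x (w i)
    have ht0 : 0 ≤ p / (16 * N) := by positivity
    have ht1 : p / (16 * N) ≤ 1 / 16 := by
      rw [div_le_iff₀ (by positivity)]; linarith
    have hc : |q / (16 * N) ^ 2| ≤ 1 / 64 :=
      abs_div_le_of_le_mul (by positivity) (hq.trans (by linarith))
    obtain ⟨hc1, hc2⟩ := abs_le.1 hc
    have hi : ((i : ℕ) : ℝ) + 1 ≤ N := by exact_mod_cast i.2
    have hi0 : (0 : ℝ) ≤ (i : ℕ) := Nat.cast_nonneg _
    have hQ : (0 : ℝ) < (16 * N) ^ 2 := by positivity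
    refine ⟨(i : ℕ) + p / (16 * N),
      2 * (i : ℕ) * ((i : ℕ) + p / (16 * N)) - (i : ℕ) ^ 2 - q / (16 * N) ^ 2,
      by positivity, by linarith, ?_, ?_, ?_, ?_, ?_⟩
    · rw [abs_le]
      constructor <;> nlinarith
    · intro l hl
      simp only [List.mem_flatMap, List.mem_map] at hl
      obtain ⟨j, -, l, hl, rfl⟩ := hl
      by_cases hij : i = j
      · subst hij
        rw [lineEval_tangentLine_self hN]
        have := div_le_div_of_nonneg_right (hg l hl) hQ.le
        linarith
      · exact lineEval_tangentLine_le hN (fun h => hij (Fin.ext h))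
          (h.admissible_right _ l hl) hp0 hpN hq
    · intro l hl
      obtain ⟨l₀, hl₀, rfl⟩ := List.mem_map.1 hl
      rw [lineEval_tangentLine_self hN]
      have := div_le_div_of_nonneg_right (hf l₀ hl₀) hQ.le
      linarith
    · refine ⟨tangentLine N i l', ?_, tangentLine N i l, List.mem_map.2 ⟨l, hl, rfl⟩, ?_, ?_, ?_⟩
      · simp only [List.mem_flatMap, List.mem_map]
        exact ⟨i, List.mem_finRange i, l', hl', rfl⟩
      · rw [lineEval_tangentLine_self hN, e']
      · rw [lineEval_tangentLine_self hN, e]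
      · have := div_lt_div_of_pos_right hlt (by positivity : (0 : ℝ) < 16 * N)
        simp only [tangentLine]
        linarith
    -- The shift by `i` is even in the finer units, so the parity of `z` survives.
    · refine ⟨i * (16 * N) ^ (k + 1) + z, ?_, ?_⟩
      · push_cast
        rw [← hz, pow_succ]
        field_simp
      · have : Even ((i : ℤ) * (16 * N) ^ (k + 1)) := by
          refine Even.mul_left ?_ _
          refine (Even.mul_right (by decide) _).pow_of_ne_zero (Nat.succ_ne_zero k)
        rw [← hodd, Int.odd_add', iff_true_right this]

end CrossingFamily

/-! ### Hard instances for every number of rounds. -/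

/-- For every number `k` of rounds there is a crossing family for which short messages do not
reveal the parity of the crossing. -/
theorem exists_hard_crossingFamily {N : ℕ} (hN : 1 ≤ N) (s : ℕ) {lam : ℝ} (hl0 : 0 < lam)
    (hl1 : lam ≤ 1) (k : ℕ) :
    ∃ (X Y : Type) (_ : Fintype X) (_ : Fintype Y) (_ : Nonempty X) (_ : Nonempty Y)
      (f : X → List (ℝ × ℝ)) (g : Y → List (ℝ × ℝ)) (F : X → Y → Bool),
      CrossingFamily N k f g F ∧ ∀ o, Computes (Fin s → Bool) k o →
        ∑ x, ∑ y, (if o x y = F x y then (1 : ℝ) else 0) ≤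
          (1 / 2 + k * (lam + s / (lam * N))) * (Fintype.card X * Fintype.card Y) := by
  induction k with
  | zero =>
    refine ⟨Unit, Bool, inferInstance, inferInstance, inferInstance, inferInstance, _, _, _,
      CrossingFamily.base hN, ?_⟩
    rintro o ⟨h, hh⟩
    simp only [hh, Fintype.univ_punit, Finset.sum_singleton, Fintype.sum_bool]
    cases h PUnit.unit <;> norm_num
  | succ k ih =>
    obtain ⟨X, Y, _, _, _, _, f, g, F, hfam, hF⟩ := ih
    have : Nonempty (Fin N) := ⟨⟨0, hN⟩⟩
    classical
    refine ⟨Fin N → Y, Fin N × X, inferInstance, inferInstance, inferInstance, inferInstance,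
      _, _, _, hfam.succ hN, fun o ho => ?_⟩
    refine (sum_agree_index_le hN hl0 hl1 hF o ho).trans_eq ?_
    push_cast
    ring

/-! ### From line families to integral linear programs and streams. -/

open MeasureTheory

/-- All numbers of the constraint are integers of absolute value at most `M`. -/
def LinearConstraint.IntegralBoundedBy {d : ℕ} (C : LinearConstraint d) (M : ℕ) : Prop :=
  (∀ i, ∃ z : ℤ, C.coeff i = z ∧ |z| ≤ M) ∧ ∃ z : ℤ, C.bound = z ∧ |z| ≤ M

/-- The linear program that minimizes the first coordinate; its stream consists of the
constraints of `u`, padded to length `a`, and those of `v`, padded to length `b`. -/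
def twoPartyLP (a b : ℕ) (u v : List (LinearConstraint 2)) : LinearProgram 2 (a + b) where
  objective := ![1, 0]
  constraint := Fin.addCases (fun j => u.getD j ⟨0, 0⟩) (fun j => v.getD j ⟨0, 0⟩)

section twoPartyLP

variable {a b : ℕ} {u v : List (LinearConstraint 2)}

theorem twoPartyLP_constraint_castAdd (j : Fin a) :
    (twoPartyLP a b u v).constraint (Fin.castAdd b j) = u.getD j ⟨0, 0⟩ := by
  simp only [twoPartyLP, Fin.addCases_left]

theorem twoPartyLP_constraint_natAdd (j : Fin b) :
    (twoPartyLP a b u v).constraint (Fin.natAdd a j) = v.getD j ⟨0, 0⟩ := by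
  simp only [twoPartyLP, Fin.addCases_right]

theorem twoPartyLP_value (x : Fin 2 → ℝ) : (twoPartyLP a b u v).value x = x 0 := by
  simp [LinearProgram.value, twoPartyLP, Fin.sum_univ_two]

theorem getD_of_forall_mem {α : Type*} {p : α → Prop} {c : α} {l : List α} (hc : p c)
    (h : ∀ x ∈ l, p x) (j : ℕ) : p (l.getD j c) := by
  rcases lt_or_ge j l.length with hj | hj
  · rw [List.getD_eq_getElem _ _ hj]
    exact h _ (List.getElem_mem hj)
  · rwa [List.getD_eq_default _ _ hj]

theorem twoPartyLP_forall_constraint {p : LinearConstraint 2 → Prop} (h0 : p ⟨0, 0⟩)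
    (hu : ∀ C ∈ u, p C) (hv : ∀ C ∈ v, p C) (j) : p ((twoPartyLP a b u v).constraint j) := by
  induction j using Fin.addCases with
  | left j => exact twoPartyLP_constraint_castAdd (u := u) j ▸ getD_of_forall_mem h0 hu j
  | right j => exact twoPartyLP_constraint_natAdd (v := v) j ▸ getD_of_forall_mem h0 hv j

theorem twoPartyLP_feasible_iff (ha : u.length ≤ a) (hb : v.length ≤ b) (x : Fin 2 → ℝ) :
    (twoPartyLP a b u v).Feasible x ↔ (∀ C ∈ u, C.Holds x) ∧ ∀ C ∈ v, C.Holds x := by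
  refine ⟨fun h => ⟨fun C hC => ?_, fun C hC => ?_⟩, fun h => twoPartyLP_forall_constraint
    (p := fun C => C.Holds x) (by simp [LinearConstraint.Holds]) h.1 h.2⟩
  · obtain ⟨j, hj, rfl⟩ := List.mem_iff_getElem.1 hC
    have := h (Fin.castAdd b ⟨j, hj.trans_le ha⟩)
    rwa [twoPartyLP_constraint_castAdd, List.getD_eq_getElem _ _ hj] at this
  · obtain ⟨j, hj, rfl⟩ := List.mem_iff_getElem.1 hC
    have := h (Fin.natAdd a ⟨j, hj.trans_le hb⟩)
    rwa [twoPartyLP_constraint_natAdd, List.getD_eq_getElem _ _ hj] at this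

theorem twoPartyLP_integralBoundedBy {M : ℕ} (hM : 1 ≤ M)
    (hu : ∀ C ∈ u, C.IntegralBoundedBy M) (hv : ∀ C ∈ v, C.IntegralBoundedBy M) :
    (twoPartyLP a b u v).IntegralBoundedBy M := by
  have h := twoPartyLP_forall_constraint (a := a) (b := b)
    (p := fun C => C.IntegralBoundedBy M)
    ⟨fun i => ⟨0, by simp⟩, 0, by simp⟩ hu hv
  refine ⟨fun i => ?_, fun j => (h j).1, fun j => (h j).2⟩
  fin_cases i
  · exact ⟨1, by simp [twoPartyLP], by simpa using hM⟩
  · exact ⟨0, by simp [twoPartyLP], by simp⟩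

end twoPartyLP

/-- A streaming algorithm with `r + 1` passes gives a protocol with `2 * r + 1` messages. -/
theorem StreamingAlgorithm.computes_run {a b r s : ℕ} (A : StreamingAlgorithm 2 (a + b) (r + 1) s)
    {X Y : Type} (u : X → List (LinearConstraint 2)) (v : Y → List (LinearConstraint 2))
    (dec : (Fin 2 → ℝ) → Bool) :
    Computes (Fin s → Bool) (2 * r + 1)
      (fun x y => dec (A.run (twoPartyLP a b (u x) (v y)))) := by
  have := Computes.of_foldl (fun m => dec (A.answer ![1, 0] m)) r
    (fun t m (x : X) => Fin.foldl a (fun m j =>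
      A.step ![1, 0] t (Fin.castAdd b j) m ((u x).getD j ⟨0, 0⟩)) m)
    (fun t m (y : Y) => Fin.foldl b (fun m j =>
      A.step ![1, 0] t (Fin.natAdd a j) m ((v y).getD j ⟨0, 0⟩)) m) (A.start ![1, 0])
  convert this using 5 with x y
  refine congrArg (fun step => A.answer ![1, 0] (Fin.foldl (r + 1) step (A.start ![1, 0]))) ?_
  funext m t
  rw [StreamingAlgorithm.onePass, Fin.foldl_add]
  simp only [twoPartyLP_constraint_natAdd]
  congr 2
  funext m j
  exact congrArg _ (twoPartyLP_constraint_castAdd j)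

/-- The constraint that a point lies above a line, multiplied by `D`. -/
def aboveLine (D : ℝ) (l : ℝ × ℝ) : LinearConstraint 2 := ⟨![D * l.1, -D], -(D * l.2)⟩

/-- The constraint that a point lies below a line, multiplied by `D`. -/
def belowLine (D : ℝ) (l : ℝ × ℝ) : LinearConstraint 2 := ⟨![-(D * l.1), D], D * l.2⟩

theorem aboveLine_holds {D : ℝ} (hD : 0 < D) (l : ℝ × ℝ) (x : Fin 2 → ℝ) :
    (aboveLine D l).Holds x ↔ lineEval l (x 0) ≤ x 1 := by
  rw [← mul_le_mul_iff_right₀ hD]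
  simp only [LinearConstraint.Holds, aboveLine, lineEval, Fin.sum_univ_two, Matrix.cons_val_zero,
    Matrix.cons_val_one]
  constructor <;> intro h <;> linarith

theorem belowLine_holds {D : ℝ} (hD : 0 < D) (l : ℝ × ℝ) (x : Fin 2 → ℝ) :
    (belowLine D l).Holds x ↔ x 1 ≤ lineEval l (x 0) := by
  rw [← mul_le_mul_iff_right₀ hD]
  simp only [LinearConstraint.Holds, belowLine, lineEval, Fin.sum_univ_two, Matrix.cons_val_zero,
    Matrix.cons_val_one]
  constructor <;> intro h <;> linarith

theorem AdmissibleLine.exists_int {N k M : ℕ} (hN : 1 ≤ N) {l : ℝ × ℝ}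
    (hl : AdmissibleLine N k l) (hM : (16 * N) ^ (2 * k) * (4 * N ^ 2) ≤ M) :
    ∃ A B D : ℤ, (16 * (N : ℝ)) ^ (2 * k) * l.1 = A ∧ (16 * (N : ℝ)) ^ (2 * k) * l.2 = B ∧
      (16 * (N : ℝ)) ^ (2 * k) = D ∧ |A| ≤ M ∧ |B| ≤ M ∧ |D| ≤ M := by
  have hNR : (1 : ℝ) ≤ N := by exact_mod_cast hN
  have hMR : (16 * (N : ℝ)) ^ (2 * k) * (4 * N ^ 2) ≤ M := by exact_mod_cast hM
  have hD : 0 < (16 * (N : ℝ)) ^ (2 * k) := by positivity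
  obtain ⟨A, hA⟩ := hl.slope_int
  obtain ⟨B, hB⟩ := hl.intercept_int
  rw [mul_comm] at hA hB
  have cast_le : ∀ z : ℤ, |(z : ℝ)| ≤ M → |z| ≤ M := fun z hz => by exact_mod_cast hz
  have le_M : ∀ c : ℝ, |c| ≤ 4 * N ^ 2 → |(16 * (N : ℝ)) ^ (2 * k) * c| ≤ M := by
    intro c hc
    rw [abs_mul, abs_of_pos hD]
    exact (mul_le_mul_of_nonneg_left hc hD.le).trans hMR
  refine ⟨A, B, (16 * N) ^ (2 * k), hA, hB, by push_cast; rfl, cast_le _ ?_, cast_le _ ?_,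
    cast_le _ ?_⟩
  · rw [← hA]
    exact le_M _ (hl.slope_le.trans (by nlinarith))
  · rw [← hB]
    exact le_M _ hl.intercept_le
  · have := le_M 1 (by rw [abs_one]; nlinarith)
    push_cast
    rwa [mul_one] at this

theorem AdmissibleLine.aboveLine_integral {N k M : ℕ} (hN : 1 ≤ N) {l : ℝ × ℝ}
    (hl : AdmissibleLine N k l) (hM : (16 * N) ^ (2 * k) * (4 * N ^ 2) ≤ M) :
    (aboveLine ((16 * N) ^ (2 * k)) l).IntegralBoundedBy M := by
  obtain ⟨A, B, D, hA, hB, hD, hA', hB', hD'⟩ := hl.exists_int hN hM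
  refine ⟨fun i => ?_, -B, by simp [aboveLine, hB], by rwa [abs_neg]⟩
  fin_cases i
  · exact ⟨A, by simp [aboveLine, hA], hA'⟩
  · exact ⟨-D, by simp [aboveLine, hD], by rwa [abs_neg]⟩

theorem AdmissibleLine.belowLine_integral {N k M : ℕ} (hN : 1 ≤ N) {l : ℝ × ℝ}
    (hl : AdmissibleLine N k l) (hM : (16 * N) ^ (2 * k) * (4 * N ^ 2) ≤ M) :
    (belowLine ((16 * N) ^ (2 * k)) l).IntegralBoundedBy M := by
  obtain ⟨A, B, D, hA, hB, hD, hA', hB', hD'⟩ := hl.exists_int hN hM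
  refine ⟨fun i => ?_, B, by simp [belowLine, hB], hB'⟩
  fin_cases i
  · exact ⟨-A, by simp [belowLine, hA], by rwa [abs_neg]⟩
  · exact ⟨D, by simp [belowLine, hD], hD'⟩

/-- The program of the region above the lines of one list and below those of another. -/
noncomputable def crossingLP (N k a b : ℕ) (u v : List (ℝ × ℝ)) : LinearProgram 2 (a + b) :=
  twoPartyLP a b (u.map (aboveLine ((16 * N) ^ (2 * k)))) (v.map (belowLine ((16 * N) ^ (2 * k))))

section crossingLP

variable {N k a b : ℕ} {X Y : Type} {f : X → List (ℝ × ℝ)} {g : Y → List (ℝ × ℝ)}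
  {F : X → Y → Bool}

theorem CrossingFamily.crossingLP_integralBoundedBy (h : CrossingFamily N k f g F) (hN : 1 ≤ N)
    {M : ℕ} (hM : (16 * N) ^ (2 * k) * (4 * N ^ 2) ≤ M) (x : X) (y : Y) :
    (crossingLP N k a b (f x) (g y)).IntegralBoundedBy M := by
  refine twoPartyLP_integralBoundedBy (le_trans (Nat.mul_pos ?_ ?_) hM) ?_ ?_
  · positivity
  · positivity
  · intro C hC
    obtain ⟨l, hl, rfl⟩ := List.mem_map.1 hC
    exact (h.admissible_left x l hl).aboveLine_integral hN hM
  · intro C hC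
    obtain ⟨l, hl, rfl⟩ := List.mem_map.1 hC
    exact (h.admissible_right y l hl).belowLine_integral hN hM

/-- The program has an optimal solution, and the optimal value reveals `F x y`. -/
theorem CrossingFamily.exists_isOptimal (h : CrossingFamily N k f g F) (hN : 1 ≤ N)
    (ha : N ^ k ≤ a) (hb : N ^ k ≤ b) (x : X) (y : Y) :
    ∃ p, (crossingLP N k a b (f x) (g y)).IsOptimal p ∧
      ∃ z : ℤ, p 0 * (16 * N) ^ k = z ∧ (Odd z ↔ F x y = true) := by
  have hNR : (1 : ℝ) ≤ N := by exact_mod_cast hN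
  have hD : 0 < (16 * (N : ℝ)) ^ (2 * k) := by positivity
  obtain ⟨p, q, -, -, -, hf, hg, ⟨l, hl, l', hl', e, e', hlt⟩, hz⟩ := h.crossing x y
  have hfeas : ∀ w, (crossingLP N k a b (f x) (g y)).Feasible w ↔
      (∀ l ∈ f x, lineEval l (w 0) ≤ w 1) ∧ ∀ l ∈ g y, w 1 ≤ lineEval l (w 0) := by
    intro w
    rw [crossingLP, twoPartyLP_feasible_iff
      (by rw [List.length_map]; exact (h.length_left x).trans ha)
      (by rw [List.length_map]; exact (h.length_right y).trans hb)]
    simp only [List.forall_mem_map, aboveLine_holds hD, belowLine_holds hD]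
  refine ⟨![p, q], ⟨(hfeas _).2 ⟨hf, hg⟩, fun w hw => ?_⟩, hz⟩
  obtain ⟨hw1, hw2⟩ := (hfeas w).1 hw
  have h1 := (hw1 l hl).trans (hw2 l' hl')
  simp only [lineEval] at h1 e e'
  simp only [crossingLP, twoPartyLP_value, Matrix.cons_val_zero]
  by_contra hlt'
  -- Left of the crossing the flatter lower bound `l` exceeds the steeper upper bound `l'`.
  nlinarith [mul_pos (sub_pos.2 hlt) (sub_pos.2 (not_le.1 hlt'))]

/-- The parity of the first coordinate of a point in units of `1 / (16 * N) ^ k`. -/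
noncomputable def decodeParity (N k : ℕ) (p : Fin 2 → ℝ) : Bool :=
  open Classical in decide (∃ z : ℤ, p 0 * (16 * N) ^ k = z ∧ Odd z)

/-- All optimal points share their first coordinate, since it is the objective value. -/
theorem CrossingFamily.decodeParity_eq (h : CrossingFamily N k f g F) (hN : 1 ≤ N)
    (ha : N ^ k ≤ a) (hb : N ^ k ≤ b) {x : X} {y : Y} {w : Fin 2 → ℝ}
    (hw : (crossingLP N k a b (f x) (g y)).IsOptimal w) : decodeParity N k w = F x y := by
  obtain ⟨p, hp, z, hz, hodd⟩ := h.exists_isOptimal hN ha hb x y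
  have h0 : w 0 = p 0 := by
    have h1 := hw.2 p hp.1
    have h2 := hp.2 w hw.1
    simp only [crossingLP, twoPartyLP_value] at h1 h2
    exact le_antisymm h1 h2
  rw [Bool.eq_iff_iff, decodeParity, @decide_eq_true_iff _ (Classical.propDecidable _), ← hodd, h0, hz]
  constructor
  · rintro ⟨z', hz', h'⟩
    rwa [Int.cast_injective hz']
  · exact fun h => ⟨z, rfl, h⟩

end crossingLP

/-! ### Averaging over seeds and the choice of parameters. -/

/-- If every seed belongs to few of the sets, then their probabilities are small on average. -/
theorem sum_measureReal_le {Ω : Type*} [MeasurableSpace Ω] (μ : Measure Ω) [IsProbabilityMeasure μ]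
    {ι : Type*} [Fintype ι] {E : ι → Set Ω} (hE : ∀ i, MeasurableSet (E i)) {B : ℝ}
    (h : ∀ ω, ∑ i, (E i).indicator (fun _ => (1 : ℝ)) ω ≤ B) : ∑ i, μ.real (E i) ≤ B := by
  have hint : ∀ i, Integrable ((E i).indicator (fun _ => (1 : ℝ))) μ :=
    fun i => (integrable_const 1).indicator (hE i)
  calc ∑ i, μ.real (E i) = ∫ ω, ∑ i, (E i).indicator (fun _ => (1 : ℝ)) ω ∂μ := by
        rw [integral_finsetSum _ fun i _ => hint i]
        simp [integral_indicator_const, hE]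
    _ ≤ ∫ _ω, B ∂μ := integral_mono (integrable_finsetSum _ fun i _ => hint i)
        (integrable_const B) h
    _ = B := by simp

/-- Without memory, no algorithm solves all programs with probability `2 / 3`. -/
theorem memory_pos {n r s M : ℕ} (hn : 1 ≤ n) (hM : 1 ≤ M) {Ω : Type*} [MeasurableSpace Ω]
    (μ : Measure Ω) [IsProbabilityMeasure μ] (A : Ω → StreamingAlgorithm 2 n r s)
    (hA : ∀ P : LinearProgram 2 n, (∃ x, P.IsOptimal x) → P.IntegralBoundedBy M →
      SolvesWithProb μ A P (2 / 3)) : 1 ≤ s := by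
  by_contra hs
  obtain rfl : s = 0 := by omega
  let P : Bool → LinearProgram 2 n := fun t =>
    ⟨![1, 0], fun _ => ⟨![-1, 0], if t then 1 else 0⟩⟩
  have hfeas : ∀ t x, (P t).Feasible x ↔ -(if t then 1 else 0) ≤ x 0 := by
    intro t x
    simp only [LinearProgram.Feasible, LinearConstraint.Holds, P, Fin.sum_univ_two,
      Matrix.cons_val_zero, Matrix.cons_val_one]
    constructor
    · intro h
      linarith [h ⟨0, hn⟩]
    · intro h _
      linarith
  have hval : ∀ t x, (P t).value x = x 0 := by
    intro t x
    simp [LinearProgram.value, P, Fin.sum_univ_two]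
  have hopt : ∀ t, (P t).IsOptimal ![-(if t then 1 else 0), 0] := by
    intro t
    refine ⟨(hfeas _ _).2 (by simp), fun y hy => ?_⟩
    simpa [hval] using (hfeas _ _).1 hy
  have huniq : ∀ t x, (P t).IsOptimal x → x 0 = -(if t then 1 else 0) := by
    intro t x hx
    refine le_antisymm ?_ ((hfeas _ _).1 hx.1)
    simpa [hval] using hx.2 _ (hopt t).1
  have hint : ∀ t, (P t).IntegralBoundedBy M := by
    have h1 : (1 : ℤ) ≤ M := by exact_mod_cast hM
    intro t
    refine ⟨fun i => ?_, fun j i => ?_, fun j => ⟨if t then 1 else 0, ?_, ?_⟩⟩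
    · fin_cases i
      · exact ⟨1, by simp [P], by simpa using hM⟩
      · exact ⟨0, by simp [P], by simp⟩
    · fin_cases i
      · exact ⟨-1, by simp [P], by simpa using hM⟩
      · exact ⟨0, by simp [P], by simp⟩
    · cases t <;> simp [P]
    · cases t <;> simp [h1]
  have hsolve := fun t => hA (P t) ⟨_, hopt t⟩ (hint t)
  have hrun : ∀ ω, (A ω).run (P true) = (A ω).run (P false) := fun ω =>
    congrArg ((A ω).answer ![1, 0]) (Subsingleton.elim _ _)
  have hsum := sum_measureReal_le μ (fun t => (hsolve t).1) (B := 1) (by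
    intro ω
    rw [Fintype.sum_bool]
    by_cases h1 : (P true).IsOptimal ((A ω).run (P true))
    · have h2 : ¬ (P false).IsOptimal ((A ω).run (P false)) := by
        intro h2
        have e1 := huniq _ _ h1
        have e2 := huniq _ _ h2
        rw [hrun, e2] at e1
        norm_num at e1
      simp [Set.indicator, h1, h2]
    · simp only [Set.indicator, Set.mem_ofPred_eq, h1, if_false, zero_add]
      split_ifs <;> norm_num)
  rw [Fintype.sum_bool] at hsum
  linarith [(hsolve true).2, (hsolve false).2]

/-- The lower bound for streams that are long enough to hold the hard programs. -/
theorem not_solves_of_le {N r a b s M : ℕ} (hs : 1 ≤ s) (hN : N = 1024 * (r + 1) ^ 2 * s)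
    (ha : N ^ (2 * r + 1) ≤ a) (hb : N ^ (2 * r + 1) ≤ b)
    (hM : (16 * N) ^ (2 * (2 * r + 1)) * (4 * N ^ 2) ≤ M) {Ω : Type*} [MeasurableSpace Ω]
    (μ : Measure Ω) [IsProbabilityMeasure μ] (A : Ω → StreamingAlgorithm 2 (a + b) (r + 1) s)
    (hA : ∀ P : LinearProgram 2 (a + b), (∃ x, P.IsOptimal x) → P.IntegralBoundedBy M →
      SolvesWithProb μ A P (2 / 3)) : False := by
  have hN1 : 1 ≤ N := by rw [hN]; exact Nat.mul_pos (by positivity) hs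
  have hsR : (1 : ℝ) ≤ s := by exact_mod_cast hs
  have hr0 : (0 : ℝ) ≤ r := Nat.cast_nonneg r
  obtain ⟨X, Y, _, _, _, _, f, g, F, hfam, hF⟩ := exists_hard_crossingFamily hN1 s
    (lam := 1 / (32 * (r + 1))) (by positivity)
    (by rw [div_le_one (by positivity)]; linarith) (2 * r + 1)
  have hX : (0 : ℝ) < Fintype.card X := by exact_mod_cast Fintype.card_pos
  have hY : (0 : ℝ) < Fintype.card Y := by exact_mod_cast Fintype.card_pos
  -- `N` is chosen so that `s / (lam * N) = lam`; the total gain is `(2 * r + 1) * 2 * lam ≤ 1 / 8`.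
  have hfrac : (1 / 2 + ((2 * r + 1 : ℕ) : ℝ) *
      (1 / (32 * (r + 1)) + s / (1 / (32 * (r + 1)) * N))) ≤ 5 / 8 := by
    have : (s : ℝ) / (1 / (32 * (r + 1)) * N) = 1 / (32 * (r + 1)) := by
      rw [hN]
      push_cast
      field_simp
      norm_num
    rw [this, ← add_div, mul_div_assoc', ← le_sub_iff_add_le', div_le_iff₀ (by positivity)]
    push_cast
    linarith
  have hsolve := fun v : X × Y => hA (crossingLP N (2 * r + 1) a b (f v.1) (g v.2))
    ((hfam.exists_isOptimal hN1 ha hb v.1 v.2).imp fun _ h => h.1)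
    (hfam.crossingLP_integralBoundedBy hN1 hM v.1 v.2)
  -- Easy direction of Yao's principle: each seed is a deterministic protocol, right on at most `5 /
  -- 8` of the inputs.
  have hsum := sum_measureReal_le μ (fun v => (hsolve v).1)
    (B := 5 / 8 * (Fintype.card X * Fintype.card Y)) (by
      intro ω
      have := hF _ ((A ω).computes_run
        (fun x => (f x).map (aboveLine ((16 * N) ^ (2 * (2 * r + 1)))))
        (fun y => (g y).map (belowLine ((16 * N) ^ (2 * (2 * r + 1)))))
        (decodeParity N (2 * r + 1)))
      refine le_trans ?_ (this.trans (mul_le_mul_of_nonneg_right hfrac (by positivity)))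
      rw [Fintype.sum_prod_type]
      refine Finset.sum_le_sum fun x _ => Finset.sum_le_sum fun y _ => ?_
      refine Set.indicator_apply_le' (fun hω => ?_) (fun _ => by split_ifs <;> norm_num)
      rw [if_pos]
      exact hfam.decodeParity_eq hN1 ha hb hω)
  have hlow : (2 / 3 : ℝ) * (Fintype.card X * Fintype.card Y) ≤
      ∑ v : X × Y, μ.real {ω | (crossingLP N (2 * r + 1) a b (f v.1) (g v.2)).IsOptimal
        ((A ω).run (crossingLP N (2 * r + 1) a b (f v.1) (g v.2)))} := by
    refine le_trans (le_of_eq ?_) (Finset.card_nsmul_le_sum _ _ (2 / 3) fun v _ => (hsolve v).2)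
    rw [Finset.card_univ, Fintype.card_prod, nsmul_eq_mul]
    push_cast
    ring
  linarith [hlow.trans hsum, mul_pos hX hY]

theorem mainTheorem3 :
    ∃ c : ℝ, 0 < c ∧ ∃ K : ℕ,
      ∀ (r n s : ℕ), 1 ≤ r → 1 ≤ n →
      ∀ (Ω : Type*) [MeasurableSpace Ω] (μ : MeasureTheory.Measure Ω)
        [MeasureTheory.IsProbabilityMeasure μ] (A : Ω → StreamingAlgorithm 2 n r s),
        (∀ P : LinearProgram 2 n, (∃ x, P.IsOptimal x) → P.IntegralBoundedBy (n ^ K) →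
          SolvesWithProb μ A P (2 / 3)) →
        c * ((1 / (r : ℝ) ^ 3) * (n : ℝ) ^ (1 / (2 * (r : ℝ)))) ≤ (s : ℝ) := by
  refine ⟨1 / 4096, by norm_num, 4, ?_⟩
  intro r n s hr hn Ω _ μ _ A hA
  -- The case `s = 0` is separate because it would give `N = 0`.
  have hs : 1 ≤ s := memory_pos hn (Nat.one_le_pow _ _ hn) μ A hA
  by_contra! hlt
  obtain ⟨r, rfl⟩ : ∃ k, r = k + 1 := ⟨r - 1, by omega⟩
  obtain ⟨N, hN⟩ : ∃ N, N = 1024 * (r + 1) ^ 2 * s := ⟨_, rfl⟩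
  have hN1 : 1 ≤ N := by rw [hN]; exact Nat.mul_pos (by positivity) hs
  -- As `4 * N = 4096 * (r + 1) ^ 2 * s`, the square would suffice here in place of the cube.
  have hroot : ((4 * N : ℕ) : ℝ) ≤ (n : ℝ) ^ (1 / (2 * ((r + 1 : ℕ) : ℝ))) := by
    have hr3 : (0 : ℝ) < ((r + 1 : ℕ) : ℝ) ^ 3 := by positivity
    have h1 : (s : ℝ) * 4096 * ((r + 1 : ℕ) : ℝ) ^ 3 ≤
        (n : ℝ) ^ (1 / (2 * ((r + 1 : ℕ) : ℝ))) := by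
      have := mul_le_mul_of_nonneg_right hlt.le hr3.le
      rw [← mul_assoc, mul_right_comm, mul_assoc (1 / 4096 : ℝ),
        one_div_mul_cancel hr3.ne', mul_one] at this
      linarith
    refine le_trans ?_ h1
    have : 4 * N ≤ s * 4096 * (r + 1) ^ 3 := by
      rw [hN]
      calc 4 * (1024 * (r + 1) ^ 2 * s) = s * 4096 * (r + 1) ^ 2 := by ring
        _ ≤ s * 4096 * (r + 1) ^ 3 := by
          gcongr
          all_goals omega
    exact_mod_cast this
  have hpow : (4 * N) ^ (2 * (r + 1)) ≤ n := by
    have h := pow_le_pow_left₀ (Nat.cast_nonneg _) hroot (2 * (r + 1))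
    have h2 : ((n : ℝ) ^ (1 / (2 * ((r + 1 : ℕ) : ℝ)))) ^ (2 * (r + 1)) = n := by
      rw [← Real.rpow_mul_natCast (Nat.cast_nonneg n)]
      push_cast
      rw [one_div_mul_cancel (by positivity), Real.rpow_one]
    rw [h2] at h
    exact_mod_cast h
  have hhalf : N ^ (2 * r + 1) + N ^ (2 * r + 1) ≤ n := by
    refine le_trans ?_ hpow
    calc N ^ (2 * r + 1) + N ^ (2 * r + 1) = 2 * N ^ (2 * r + 1) := by ring
      _ ≤ (4 * N) * (4 * N) ^ (2 * r + 1) := by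
        gcongr
        · omega
        · omega
      _ = (4 * N) ^ (2 * (r + 1)) := by ring
  -- With `16 * N ≤ (4 * N) ^ 2` the exponent is `8 * r + 6`, at most four times `2 * (r + 1)`;
  -- hence `K = 4`.
  have hM : (16 * N) ^ (2 * (2 * r + 1)) * (4 * N ^ 2) ≤ n ^ 4 := by
    calc (16 * N) ^ (2 * (2 * r + 1)) * (4 * N ^ 2)
        ≤ ((4 * N) ^ 2) ^ (2 * (2 * r + 1)) * (4 * N) ^ 2 := by
          gcongr <;> nlinarith
      _ = (4 * N) ^ (8 * r + 6) := by rw [← pow_mul, ← pow_add]; ring_nf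
      _ ≤ (4 * N) ^ (8 * r + 8) := Nat.pow_le_pow_right (by omega) (by omega)
      _ = ((4 * N) ^ (2 * (r + 1))) ^ 4 := by rw [← pow_mul]; ring_nf
      _ ≤ n ^ 4 := Nat.pow_le_pow_left hpow 4
  obtain ⟨b, rfl⟩ : ∃ b, n = N ^ (2 * r + 1) + b := ⟨n - N ^ (2 * r + 1), by omega⟩
  exact not_solves_of_le hs hN le_rfl (by omega) hM μ A hA
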